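/- Let $L_1, C_1, r_1, E > 0$ and $P \ge 0$ be real numbers, and consider the system $$L_1 \dot i_1 = -r_1 i_1 - v_1 + E, \qquad C_1 \dot v_1 = i_1 - \frac{P}{v_1}$$ on the state space $\{(i_1,v_1)\in\mathbb{R}^2 : v_1 > 0\}$. Put $\Delta = E^2 - 4 P r_1$. Real equilibrium points exist if and only if $\Delta \ge 0$, and in that case $$(\bar i_1, \bar v_1) = \left(\frac{E - \sqrt{\Delta}}{2 r_1},\ \frac{E + \sqrt{\Delta}}{2}\right)$$ denotes the equilibrium point with the highest voltage. Stability and asymptotic stability are meant in the (local) sense of Lyapunov, and "$(\bar i_1, \bar v_1)$ is stable" includes that this equilibrium point is real. (a) Suppose that $C_1 < L_1/r_1^2$. If $(\bar i_1, \bar v_1)$ is stable, then $$P \le \frac{E^2 C_1 L_1 r_1}{(L_1 + C_1 r_1^2)^2},$$ and if this inequality holds strictly, then $(\bar i_1, \bar v_1)$ is asymptotically stable. (b) Suppose that $C_1 \ge L_1/r_1^2$. Then $(\bar i_1, \bar v_1)$ is stable if and only if $$P < \frac{E^2}{4 r_1}.$$ -/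

import Mathlib

namespace CPL

section General

variable {V : Type*} [NormedAddCommGroup V] [NormedSpace ℝ V]

/-- `x` is a solution, defined for all times `t ≥ 0` and staying in the state space `X`, of the
autonomous equation `x' = f x` with initial value `x₀` (the derivative at `t = 0` is one-sided). -/
def IsSolution (f : V → V) (X : Set V) (x₀ : V) (x : ℝ → V) : Prop :=
  x 0 = x₀ ∧ ∀ t : ℝ, 0 ≤ t → x t ∈ X ∧ HasDerivWithinAt x (f (x t)) (Set.Ici 0) t

/-- `xe` is an equilibrium point of `x' = f x` on the state space `X`. -/
def IsEquilibrium (f : V → V) (X : Set V) (xe : V) : Prop :=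
  xe ∈ X ∧ f xe = 0

/-- Lyapunov stability of the equilibrium point `xe`: solutions that start close enough to `xe`
exist for all positive times and remain as close to `xe` as desired. -/
def IsStable (f : V → V) (X : Set V) (xe : V) : Prop :=
  IsEquilibrium f X xe ∧
    ∀ ε : ℝ, 0 < ε → ∃ δ : ℝ, 0 < δ ∧ ∀ x₀ ∈ X, dist x₀ xe < δ →
      (∃ x : ℝ → V, IsSolution f X x₀ x) ∧
      ∀ x : ℝ → V, IsSolution f X x₀ x → ∀ t : ℝ, 0 ≤ t → dist (x t) xe < ε

/-- (Local) asymptotic stability: stability together with attractivity. -/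
def IsAsymptoticallyStable (f : V → V) (X : Set V) (xe : V) : Prop :=
  IsStable f X xe ∧
    ∃ δ : ℝ, 0 < δ ∧ ∀ x₀ ∈ X, dist x₀ xe < δ →
      ∀ x : ℝ → V, IsSolution f X x₀ x → Filter.Tendsto x Filter.atTop (nhds xe)

end General

/-- The state space `{(i₁, v₁) : v₁ > 0}`. -/
def stateSpace : Set (ℝ × ℝ) := {x | 0 < x.2}

/-- The open-loop network in the state `x = (i₁, v₁)`:
`L₁ i₁' = -r₁ i₁ - v₁ + E`, `C₁ v₁' = i₁ - P / v₁`. -/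
noncomputable def network (L₁ C₁ r₁ E P : ℝ) (x : ℝ × ℝ) : ℝ × ℝ :=
  ((-r₁ * x.1 - x.2 + E) / L₁, (x.1 - P / x.2) / C₁)

/-- The discriminant `Δ = E² - 4 P r₁`. -/
def discr (r₁ E P : ℝ) : ℝ := E ^ 2 - 4 * P * r₁

/-- The point `(ī₁, v̄₁) = ((E - √Δ) / (2 r₁), (E + √Δ) / 2)`, i.e. the equilibrium point with the
highest voltage. If `Δ < 0` there is no real equilibrium point; then the value of this
expression is not an equilibrium point, and so it is not stable in the sense of `IsStable`. -/
noncomputable def equilibriumPoint (r₁ E P : ℝ) : ℝ × ℝ :=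
  ((E - √(discr r₁ E P)) / (2 * r₁), (E + √(discr r₁ E P)) / 2)

end CPL

/-!
Where the linearization `A` has positive determinant, `adj A * A = det A` and `A + adj A = trace A`
make `‖adj A z‖² + det A ‖z‖²` an explicit quadratic form whose derivative along the linearized flow
is `2 det A · trace A · ‖z‖²`. By the theorems of Lyapunov and Chetaev the sign of the trace thus
decides between asymptotic stability and instability. At the equilibrium with the highest voltage
the determinant has the sign of `√Δ` and the trace that of
`(L₁ - C₁ r₁²) E - (L₁ + C₁ r₁²) √Δ`, which vanishes exactly at the critical power of part (a).
At the saddle-node `Δ = 0` the linearization has a kernel, and a cubic Chetaev function proves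
instability.
-/

namespace CPL

open Filter Metric Set Topology
open scoped NNReal

section Solutions

variable {V : Type*} [NormedAddCommGroup V] [NormedSpace ℝ V]

lemma hasDerivWithinAt_Ici_of_Icc {x : ℝ → V} {x' : V} {t T : ℝ} (ht : t < T)
    (h : HasDerivWithinAt x x' (Icc 0 T) t) : HasDerivWithinAt x x' (Ici 0) t :=
  h.mono_of_mem_nhdsWithin <| by
    rw [← Ici_inter_Iic]
    exact inter_mem_nhdsWithin _ (Iic_mem_nhds ht)

lemma eqOn_Icc_of_hasDerivWithinAt {g : V → V} {K : ℝ≥0} (hg : LipschitzWith K g) {x y : ℝ → V}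
    {S T s : ℝ} (hx : ∀ t ∈ Icc 0 S, HasDerivWithinAt x (g (x t)) (Icc 0 S) t)
    (hy : ∀ t ∈ Icc 0 T, HasDerivWithinAt y (g (y t)) (Icc 0 T) t) (h0 : x 0 = y 0)
    (hS : s ≤ S) (hT : s ≤ T) : EqOn x y (Icc 0 s) := by
  have restrict {z : ℝ → V} {R : ℝ} (hR : s ≤ R)
      (hz : ∀ t ∈ Icc 0 R, HasDerivWithinAt z (g (z t)) (Icc 0 R) t) :
      ContinuousOn z (Icc 0 s) ∧ ∀ t ∈ Ico 0 s, HasDerivWithinAt z (g (z t)) (Ici t) t :=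
    ⟨fun t ht => (hz t ⟨ht.1, ht.2.trans hR⟩).continuousWithinAt.mono (Icc_subset_Icc_right hR),
      fun t ht => (hasDerivWithinAt_Ici_of_Icc (ht.2.trans_le hR)
        (hz t ⟨ht.1, ht.2.le.trans hR⟩)).mono (Ici_subset_Ici.2 ht.1)⟩
  exact ODE_solution_unique_of_mem_Icc_right (v := fun _ => g) (s := fun _ => univ)
    (fun _ _ => hg.lipschitzOnWith) (restrict hS hx).1 (restrict hS hx).2 (fun _ _ => mem_univ _)
    (restrict hT hy).1 (restrict hT hy).2 (fun _ _ => mem_univ _) h0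

lemma exists_isSolution_of_forall_nat {g : V → V} {K : ℝ≥0} (hg : LipschitzWith K g) {x₀ : V}
    (h : ∀ n : ℕ, ∃ x : ℝ → V, x 0 = x₀ ∧
      ∀ t ∈ Icc (0 : ℝ) n, HasDerivWithinAt x (g (x t)) (Icc (0 : ℝ) n) t) :
    ∃ x : ℝ → V, IsSolution g univ x₀ x := by
  choose α hα₀ hα using h
  have heq {m n : ℕ} {s : ℝ} (hs : 0 ≤ s) (hm : s ≤ m) (hn : s ≤ n) : α m s = α n s :=
    eqOn_Icc_of_hasDerivWithinAt hg (hα m) (hα n) ((hα₀ m).trans (hα₀ n).symm) hm hn ⟨hs, le_rfl⟩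
  refine ⟨fun t => α ⌈t⌉₊ t, hα₀ _, fun t ht => ⟨mem_univ _, ?_⟩⟩
  have hlt : t < (⌈t⌉₊ + 1 : ℕ) := (Nat.le_ceil t).trans_lt (by simp)
  have hderiv := hasDerivWithinAt_Ici_of_Icc hlt (hα _ t ⟨ht, hlt.le⟩)
  rw [heq ht hlt.le (Nat.le_ceil t)] at hderiv
  refine hderiv.congr_of_eventuallyEq ?_ (heq ht (Nat.le_ceil t) hlt.le)
  filter_upwards [self_mem_nhdsWithin, mem_nhdsWithin_of_mem_nhds (Iic_mem_nhds hlt)] with s hs hsT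
  exact heq hs (Nat.le_ceil s) hsT

theorem exists_isSolution_of_bounded [CompleteSpace V] {g : V → V} {K M : ℝ≥0}
    (hg : LipschitzWith K g) (hM : ∀ x, ‖g x‖ ≤ M) (x₀ : V) :
    ∃ x : ℝ → V, IsSolution g univ x₀ x := by
  refine exists_isSolution_of_forall_nat hg fun n => ?_
  have hpl : IsPicardLindelof (fun _ => g) (tmin := 0) (tmax := (n : ℝ))
      ⟨0, left_mem_Icc.2 n.cast_nonneg⟩ x₀ (M * n) 0 M K :=
    .of_time_independent (fun x _ => hM x) hg.lipschitzOnWith (by simp)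
  exact hpl.exists_eq_forall_mem_Icc_hasDerivWithinAt₀

lemma IsSolution.comp_add_const {f : V → V} {X : Set V} {x₀ : V} {x : ℝ → V} {T : ℝ}
    (hx : IsSolution f X x₀ x) (hT : 0 ≤ T) : IsSolution f X (x T) (fun t => x (t + T)) := by
  have hmaps : MapsTo (fun s => s + T) (Ici 0) (Ici 0) := fun s hs => add_nonneg hs hT
  refine ⟨congrArg x (zero_add T), fun t ht => ⟨(hx.2 _ (add_nonneg ht hT)).1, ?_⟩⟩
  simpa only [Function.comp_def, one_smul] using (hx.2 _ (add_nonneg ht hT)).2.scomp t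
    ((hasDerivAt_id' t).add_const T).hasDerivWithinAt hmaps

lemma exists_contDiff_hasCompactSupport_eventuallyEq [FiniteDimensional ℝ V] {f : V → V} {e : V}
    (hf : ContDiffAt ℝ 1 f e) :
    ∃ g : V → V, ContDiff ℝ 1 g ∧ HasCompactSupport g ∧ g =ᶠ[𝓝 e] f := by
  obtain ⟨ρ, hρ, hball⟩ := eventually_nhds_iff_ball.1 (hf.eventually (by simp))
  let χ : ContDiffBump e := ⟨ρ / 3, ρ / 2, by positivity, by linarith⟩
  refine ⟨fun x => χ x • f x, contDiff_iff_contDiffAt.2 fun x => ?_, χ.hasCompactSupport.smul_right,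
    χ.eventuallyEq_one.mono fun x hx => by simp [hx]⟩
  by_cases hx : x ∈ tsupport χ
  · rw [χ.tsupport_eq] at hx
    exact χ.contDiffAt.smul (hball x (closedBall_subset_ball (half_lt_self hρ) hx))
  · refine (contDiffAt_const (c := 0)).congr_of_eventuallyEq ?_
    filter_upwards [notMem_tsupport_iff_eventuallyEq.1 hx] with y hy
    simp [hy]

end Solutions

section Lyapunov

variable {V : Type*} [NormedAddCommGroup V] [NormedSpace ℝ V] {f : V → V} {X : Set V} {W : V → ℝ}
  {e x₀ : V} {x : ℝ → V}

/-- The orbital derivative of `W` along the vector field `f`: its value at `x t` is the derivative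
of `t ↦ W (x t)` for every solution of `x' = f x`. -/
noncomputable def orbitalDeriv (f : V → V) (W : V → ℝ) (x : V) : ℝ := fderiv ℝ W x (f x)

lemma orbitalDeriv_neg (f : V → V) (W : V → ℝ) (x : V) :
    orbitalDeriv f (fun y => -W y) x = -orbitalDeriv f W x := by
  simp [orbitalDeriv]

lemma continuousOn_orbitalDeriv {s : Set V} (hf : ContinuousOn f s) (hW : ContDiff ℝ 1 W) :
    ContinuousOn (orbitalDeriv f W) s :=
  (hW.continuous_fderiv one_ne_zero).continuousOn.clm_apply hf

namespace IsSolution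

lemma hasDerivWithinAt_comp (hx : IsSolution f X x₀ x) (hW : Differentiable ℝ W) {t : ℝ}
    (ht : 0 ≤ t) : HasDerivWithinAt (W ∘ x) (orbitalDeriv f W (x t)) (Ici t) t :=
  ((hW (x t)).hasFDerivAt.comp_hasDerivWithinAt t (hx.2 t ht).2).mono (Ici_subset_Ici.2 ht)

lemma continuousOn (hx : IsSolution f X x₀ x) : ContinuousOn x (Ici 0) :=
  fun t ht => (hx.2 t ht).2.continuousWithinAt

lemma continuousOn_comp (hx : IsSolution f X x₀ x) (hW : Differentiable ℝ W) (t : ℝ) :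
    ContinuousOn (W ∘ x) (Icc 0 t) :=
  hW.continuous.comp_continuousOn (hx.continuousOn.mono Icc_subset_Ici_self)

lemma comp_le_of_orbitalDeriv_nonpos (hx : IsSolution f X x₀ x) (hW : Differentiable ℝ W) {t : ℝ}
    (ht : 0 ≤ t) (h : ∀ s ∈ Ico 0 t, orbitalDeriv f W (x s) ≤ 0) : W (x t) ≤ W x₀ :=
  image_le_of_deriv_right_le_deriv_boundary (B := fun _ => W x₀) (hx.continuousOn_comp hW t)
    (fun _ hs => hx.hasDerivWithinAt_comp hW hs.1) (congrArg W hx.1).le continuousOn_const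
    (fun s _ => hasDerivWithinAt_const s _ _) h (right_mem_Icc.2 ht)

lemma le_comp_of_orbitalDeriv_pos (hx : IsSolution f X x₀ x) (hW : Differentiable ℝ W) {t : ℝ}
    (ht : 0 ≤ t) (h : ∀ s ∈ Ico 0 t, W (x s) = W x₀ → 0 < orbitalDeriv f W (x s)) :
    W x₀ ≤ W (x t) :=
  neg_le_neg_iff.1 <| image_le_of_deriv_right_lt_deriv_boundary (B := fun _ => -W x₀)
    (hx.continuousOn_comp hW t).neg (fun _ hs => (hx.hasDerivWithinAt_comp hW hs.1).neg)
    (congrArg (fun y => -W y) hx.1).le (fun s => hasDerivAt_const s _)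
    (fun s hs hsW => neg_lt_zero.2 (h s hs (neg_injective hsW))) (right_mem_Icc.2 ht)

theorem exists_notMem_of_orbitalDeriv_pos (hx : IsSolution f X x₀ x) (hW : ContDiff ℝ 1 W)
    {K : Set V} (hK : IsCompact K) (hf : ContinuousOn f K)
    (hpos : ∀ y ∈ K, 0 < orbitalDeriv f W y) : ∃ t, 0 ≤ t ∧ x t ∉ K := by
  by_contra! hmem
  obtain ⟨c, hc, hcK⟩ := hK.exists_forall_le' (continuousOn_orbitalDeriv hf hW) hpos
  obtain ⟨M, hM⟩ := hK.bddAbove_image hW.continuous.continuousOn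
  have hWM {t : ℝ} (ht : 0 ≤ t) : W (x t) ≤ M := hM (mem_image_of_mem W (hmem t ht))
  have hgrowth {t : ℝ} (ht : 0 ≤ t) : W x₀ + c * t ≤ W (x t) :=
    image_le_of_deriv_right_le_deriv_boundary (f := fun s => W x₀ + c * s) (by fun_prop)
      (fun s _ => (((hasDerivAt_id' s).const_mul c).const_add _).hasDerivWithinAt)
      (by simp [hx.1]) (hx.continuousOn_comp (hW.differentiable one_ne_zero) t)
      (fun s hs => hx.hasDerivWithinAt_comp (hW.differentiable one_ne_zero) hs.1)
      (fun s hs => by simpa only [mul_one] using hcK _ (hmem s hs.1)) (right_mem_Icc.2 ht)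
  have hx₀ : W x₀ ≤ M := hx.1 ▸ hWM le_rfl
  have ht : 0 ≤ (M - W x₀ + 1) / c := by have := sub_nonneg.2 hx₀; positivity
  have := (hgrowth ht).trans (hWM ht)
  rw [mul_div_cancel₀ _ hc.ne'] at this
  linarith

end IsSolution

lemma exists_first_eq_of_le_of_le {φ : ℝ → ℝ} {a b c : ℝ} (hφ : ContinuousOn φ (Icc a b))
    (hab : a ≤ b) (ha : φ a ≤ c) (hb : c ≤ φ b) :
    ∃ t ∈ Icc a b, φ t = c ∧ ∀ s ∈ Icc a t, φ s ≤ c := by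
  have hne : (Icc a b ∩ φ ⁻¹' {c}).Nonempty := intermediate_value_Icc hab hφ ⟨ha, hb⟩
  obtain ⟨t, ⟨ht, htc⟩, hleast⟩ := (isCompact_Icc.of_isClosed_subset
    (hφ.preimage_isClosed_of_isClosed isClosed_Icc isClosed_singleton)
    inter_subset_left).exists_isLeast hne
  refine ⟨t, ht, htc, fun s hs => le_of_not_gt fun hsc => ?_⟩
  obtain ⟨u, hu, huc⟩ := intermediate_value_Icc hs.1
    (hφ.mono (Icc_subset_Icc_right (hs.2.trans ht.2))) ⟨ha, hsc.le⟩
  have hus : u = s := le_antisymm hu.2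
    (hs.2.trans (hleast ⟨⟨hu.1, hu.2.trans (hs.2.trans ht.2)⟩, huc⟩))
  exact hsc.ne' (hus ▸ huc)

variable [FiniteDimensional ℝ V]

lemma exists_forall_isSolution_dist_lt {ε : ℝ} (hε : 0 < ε) (hW : Differentiable ℝ W)
    (hpos : ∀ y ∈ sphere e ε, W e < W y) :
    ∃ δ > 0, ∀ (f : V → V) (X : Set V) (x₀ : V) (x : ℝ → V),
      (∀ y ∈ closedBall e ε, orbitalDeriv f W y ≤ 0) → IsSolution f X x₀ x → dist x₀ e < δ →
      ∀ t, 0 ≤ t → dist (x t) e < ε := by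
  obtain ⟨m, hm, hmW⟩ := (isCompact_sphere e ε).exists_forall_le' hW.continuous.continuousOn hpos
  obtain ⟨δ, hδ, hball⟩ := eventually_nhds_iff_ball.1
    ((hW.continuous.continuousAt.eventually_lt_const hm).and (ball_mem_nhds e hε))
  refine ⟨δ, hδ, fun f X x₀ x hle hx hx₀ t ht => lt_of_not_ge fun hexit => ?_⟩
  obtain ⟨hx₀m, hx₀ε⟩ := hball x₀ hx₀
  have hcont : ContinuousOn (fun s => dist (x s) e) (Icc 0 t) :=
    (continuous_id.dist continuous_const).comp_continuousOn
      (hx.continuousOn.mono Icc_subset_Ici_self)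
  obtain ⟨τ, hτ, hτε, hbefore⟩ := exists_first_eq_of_le_of_le hcont ht
    (by rw [hx.1]; exact hx₀ε.le) hexit
  have hdecr : W (x τ) ≤ W x₀ := hx.comp_le_of_orbitalDeriv_nonpos hW hτ.1
    fun s hs => hle _ (hbefore s (Ico_subset_Icc_self hs))
  exact (hdecr.trans_lt hx₀m).not_ge (hmW _ hτε)

theorem isStable_of_orbitalDeriv_nonpos (hX : X ∈ 𝓝 e) (hf₀ : f e = 0) (hf : ContDiffAt ℝ 1 f e)
    (hW : Differentiable ℝ W) (hpos : ∀ᶠ x in 𝓝[≠] e, W e < W x)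
    (hle : ∀ᶠ x in 𝓝 e, orbitalDeriv f W x ≤ 0) : IsStable f X e := by
  refine ⟨⟨mem_of_mem_nhds hX, hf₀⟩, fun ε hε => ?_⟩
  obtain ⟨g, hg, hsupp, hgf⟩ := exists_contDiff_hasCompactSupport_eventuallyEq hf
  obtain ⟨K, hK⟩ := hg.lipschitzWith_of_hasCompactSupport hsupp one_ne_zero
  obtain ⟨M, hM⟩ := hsupp.exists_bound_of_continuous hg.continuous
  obtain ⟨r, hr, hball⟩ := nhds_basis_closedBall.eventually_iff.1
    ((eventually_mem_set.2 hX).and (hgf.and ((eventually_nhdsWithin_iff.1 hpos).and hle)))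
  have hρ : 0 < min r ε := lt_min hr hε
  replace hball {y : V} (hy : dist y e ≤ min r ε) := hball (mem_closedBall.2
    (hy.trans (min_le_left r ε)))
  obtain ⟨δ, hδ, htrap⟩ := exists_forall_isSolution_dist_lt hρ hW fun y hy =>
    (hball (mem_sphere.1 hy).le).2.2.1 (ne_of_mem_sphere hy hρ.ne')
  refine ⟨δ, hδ, fun x₀ _ hx₀ => ⟨?_, fun x hx t ht => (htrap f X x₀ x
    (fun y hy => (hball hy).2.2.2) hx hx₀ t ht).trans_le (min_le_right r ε)⟩⟩
  obtain ⟨x, hx⟩ := exists_isSolution_of_bounded (M := M.toNNReal) hK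
    (fun y => (hM y).trans (Real.le_coe_toNNReal M)) x₀
  have hstay {t : ℝ} (ht : 0 ≤ t) := hball (htrap g univ x₀ x
    (fun y hy => by rw [orbitalDeriv, (hball hy).2.1]; exact (hball hy).2.2.2) hx hx₀ t ht).le
  exact ⟨x, hx.1, fun t ht => ⟨(hstay ht).1, (hstay ht).2.1 ▸ (hx.2 t ht).2⟩⟩

theorem IsStable.isAsymptoticallyStable_of_orbitalDeriv_neg (h : IsStable f X e)
    (hf : ∀ᶠ x in 𝓝 e, ContinuousAt f x) (hW : ContDiff ℝ 1 W)
    (hneg : ∀ᶠ x in 𝓝[≠] e, orbitalDeriv f W x < 0) : IsAsymptoticallyStable f X e := by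
  obtain ⟨r, hr, hball⟩ := nhds_basis_closedBall.eventually_iff.1
    (hf.and (eventually_nhdsWithin_iff.1 hneg))
  obtain ⟨δ, hδ, hstay⟩ := h.2 r hr
  refine ⟨h, δ, hδ, fun x₀ hx₀ hdist x hx => Metric.tendsto_atTop.2 fun ε hε => ?_⟩
  obtain ⟨η, hη, hclose⟩ := h.2 ε hε
  have hmem {y : V} (hy : y ∈ closedBall e r \ ball e η) :
      ContinuousAt f y ∧ orbitalDeriv f W y < 0 :=
    ⟨(hball hy.1).1, (hball hy.1).2 fun hye => hy.2 (hye ▸ mem_ball_self hη)⟩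
  obtain ⟨T, hT, hxT⟩ := hx.exists_notMem_of_orbitalDeriv_pos hW.neg
    ((isCompact_closedBall e r).diff isOpen_ball)
    (fun y hy => (hmem hy).1.continuousWithinAt) fun y hy => by
      simpa [orbitalDeriv_neg] using (hmem hy).2
  have hxη : dist (x T) e < η := by
    by_contra hfar
    exact hxT ⟨((hstay x₀ hx₀ hdist).2 x hx T hT).le, hfar⟩
  refine ⟨T, fun t ht => ?_⟩
  simpa only [sub_add_cancel] using (hclose (x T) (hx.2 T hT).1 hxη).2 _ (hx.comp_add_const hT)
    (t - T) (sub_nonneg.2 ht)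

theorem isAsymptoticallyStable_of_orbitalDeriv_neg (hX : X ∈ 𝓝 e) (hf₀ : f e = 0)
    (hf : ContDiffAt ℝ 1 f e) (hW : ContDiff ℝ 1 W) (hpos : ∀ᶠ x in 𝓝[≠] e, W e < W x)
    (hneg : ∀ᶠ x in 𝓝[≠] e, orbitalDeriv f W x < 0) : IsAsymptoticallyStable f X e := by
  have hle : ∀ᶠ x in 𝓝 e, orbitalDeriv f W x ≤ 0 := by
    filter_upwards [eventually_nhdsWithin_iff.1 hneg] with x hx
    rcases eq_or_ne x e with rfl | hxe
    · simp [orbitalDeriv, hf₀]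
    · exact (hx hxe).le
  exact (isStable_of_orbitalDeriv_nonpos hX hf₀ hf (hW.differentiable one_ne_zero) hpos
    hle).isAsymptoticallyStable_of_orbitalDeriv_neg
      ((hf.eventually (by simp)).mono fun _ h => h.continuousAt) hW hneg

theorem not_isStable_of_orbitalDeriv_pos (hX : X ∈ 𝓝 e) (hf : ∀ᶠ x in 𝓝 e, ContinuousAt f x)
    (hW : ContDiff ℝ 1 W) (hfreq : ∃ᶠ x in 𝓝 e, W e < W x)
    (hpos : ∀ᶠ x in 𝓝 e, W e < W x → 0 < orbitalDeriv f W x) : ¬IsStable f X e := by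
  intro h
  obtain ⟨r, hr, hball⟩ := nhds_basis_closedBall.eventually_iff.1 (hf.and hpos)
  obtain ⟨δ, hδ, hstay⟩ := h.2 r hr
  obtain ⟨x₀, hWx₀, hx₀X, hx₀⟩ :=
    (hfreq.and_eventually ((eventually_mem_set.2 hX).and (ball_mem_nhds e hδ))).exists
  obtain ⟨⟨x, hx⟩, hdist⟩ := hstay x₀ hx₀X hx₀
  have hxr {t : ℝ} (ht : 0 ≤ t) : x t ∈ closedBall e r := (hdist x hx t ht).le
  have hincr {t : ℝ} (ht : 0 ≤ t) : W x₀ ≤ W (x t) :=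
    hx.le_comp_of_orbitalDeriv_pos (hW.differentiable one_ne_zero) ht
      fun s hs hsW => (hball (hxr hs.1)).2 (hsW ▸ hWx₀)
  obtain ⟨t, ht, hxt⟩ := hx.exists_notMem_of_orbitalDeriv_pos hW
    ((isCompact_closedBall e r).inter_right (isClosed_le continuous_const hW.continuous))
    (fun y hy => (hball hy.1).1.continuousWithinAt)
    fun y hy => (hball hy.1).2 (hWx₀.trans_le hy.2)
  exact hxt ⟨hxr ht, hincr ht⟩

end Lyapunov

section Linearization

variable {V : Type*} [NormedAddCommGroup V] [NormedSpace ℝ V] {f : V → V} {X : Set V}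
  {A : V →L[ℝ] V} {B : V →L[ℝ] V →L[ℝ] ℝ} {e : V}

lemma orbitalDeriv_bilin (f : V → V) (B : V →L[ℝ] V →L[ℝ] ℝ) (e x : V) :
    orbitalDeriv f (fun y => B (y - e) (y - e)) x = B (x - e) (f x) + B (f x) (x - e) := by
  have hsub : HasFDerivAt (fun y => y - e) (ContinuousLinearMap.id ℝ V) x := hasFDerivAt_sub_const e
  rw [orbitalDeriv, (B.hasFDerivAt_of_bilinear hsub hsub).fderiv]
  simp

lemma contDiff_bilin_sub (B : V →L[ℝ] V →L[ℝ] ℝ) (e : V) :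
    ContDiff ℝ 1 fun x => B (x - e) (x - e) := by
  fun_prop

lemma frequently_bilin_pos {z : V} (hz : 0 < B z z) (e : V) :
    ∃ᶠ x in 𝓝 e, B (e - e) (e - e) < B (x - e) (x - e) := by
  have hlim : Tendsto (fun s : ℝ => e + s • z) (𝓝[≠] 0) (𝓝 e) := by
    refine (Continuous.tendsto' ?_ 0 e (by simp)).mono_left nhdsWithin_le_nhds
    fun_prop
  refine hlim.frequently (Eventually.frequently ?_)
  filter_upwards [self_mem_nhdsWithin] with s hs
  have : 0 < s * s * B z z := mul_pos (mul_self_pos.2 hs) hz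
  simpa [mul_assoc] using this

variable [FiniteDimensional ℝ V]

lemma isCoercive_of_forall_pos (hB : ∀ z ≠ 0, 0 < B z z) : IsCoercive B := by
  obtain ⟨c, hc, hcB⟩ := (isCompact_sphere (0 : V) 1).exists_forall_le'
    (f := fun z => B z z) (by fun_prop) fun z hz => hB z (ne_of_mem_sphere hz one_ne_zero)
  refine ⟨c, hc, fun z => ?_⟩
  rcases eq_or_ne z 0 with rfl | hz
  · simp
  have : 0 < ‖z‖ := norm_pos_iff.2 hz
  have hunit := hcB (‖z‖⁻¹ • z) (by simp [norm_smul, hz])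
  simp only [map_smul, smul_apply, smul_eq_mul] at hunit
  calc c * ‖z‖ * ‖z‖ ≤ ‖z‖⁻¹ * (‖z‖⁻¹ * B z z) * ‖z‖ * ‖z‖ := by gcongr
    _ = B z z := by field_simp

lemma eventually_orbitalDeriv_bilin_pos (hA : HasFDerivAt f A e) (hf₀ : f e = 0)
    (hpos : ∀ z ≠ 0, 0 < B z (A z) + B (A z) z) :
    ∀ᶠ x in 𝓝[≠] e, 0 < orbitalDeriv f (fun y => B (y - e) (y - e)) x := by
  obtain ⟨c, hc, hcoer⟩ := isCoercive_of_forall_pos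
    (B := B.bilinearComp (.id ℝ V) A + B.bilinearComp A (.id ℝ V)) (by simpa using hpos)
  have hη : 0 < c / (2 * ‖B‖ + 1) := by positivity
  filter_upwards [nhdsWithin_le_nhds (hA.isLittleO.def hη), self_mem_nhdsWithin] with x hx hxe
  obtain ⟨z, rfl⟩ : ∃ z, x = e + z := ⟨x - e, by abel⟩
  have hz : 0 < ‖z‖ := norm_pos_iff.2 fun hz => hxe (by simp [hz])
  obtain ⟨R, hR⟩ : ∃ R, f (e + z) = A z + R := ⟨f (e + z) - A z, by abel⟩
  simp only [hR, hf₀, add_sub_cancel_left, sub_zero] at hx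
  have hBR : |B z R + B R z| ≤ 2 * ‖B‖ * ‖z‖ * ‖R‖ := by
    have h₁ := B.le_opNorm₂ z R
    have h₂ := B.le_opNorm₂ R z
    rw [Real.norm_eq_abs] at h₁ h₂
    linarith [abs_add_le (B z R) (B R z)]
  have hsmall : 2 * ‖B‖ * ‖z‖ * ‖R‖ < c * ‖z‖ * ‖z‖ :=
    calc 2 * ‖B‖ * ‖z‖ * ‖R‖ ≤ 2 * ‖B‖ * ‖z‖ * (c / (2 * ‖B‖ + 1) * ‖z‖) := by gcongr
      _ = 2 * ‖B‖ * (c / (2 * ‖B‖ + 1) * ‖z‖ * ‖z‖) := by ring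
      _ < (2 * ‖B‖ + 1) * (c / (2 * ‖B‖ + 1) * ‖z‖ * ‖z‖) := by gcongr; linarith
      _ = c * ‖z‖ * ‖z‖ := by field_simp
  have hlin : c * ‖z‖ * ‖z‖ ≤ B z (A z) + B (A z) z := by simpa using hcoer z
  rw [orbitalDeriv_bilin, add_sub_cancel_left, hR]
  simp only [map_add, add_apply]
  linarith [neg_abs_le (B z R + B R z)]

theorem isAsymptoticallyStable_of_lyapunov_form (hX : X ∈ 𝓝 e) (hf₀ : f e = 0)
    (hf : ContDiffAt ℝ 1 f e) (hA : HasFDerivAt f A e) (hB : ∀ z ≠ 0, 0 < B z z)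
    (hneg : ∀ z ≠ 0, B z (A z) + B (A z) z < 0) : IsAsymptoticallyStable f X e := by
  refine isAsymptoticallyStable_of_orbitalDeriv_neg hX hf₀ hf (contDiff_bilin_sub B e) ?_ ?_
  · filter_upwards [self_mem_nhdsWithin] with x hx
    simpa using hB (x - e) (sub_ne_zero.2 hx)
  · filter_upwards [eventually_orbitalDeriv_bilin_pos (B := -B) hA hf₀ fun z hz => by
      simp only [neg_apply]
      linarith [hneg z hz]] with x hx
    exact neg_pos.1 (orbitalDeriv_neg f _ x ▸ hx)

theorem not_isStable_of_lyapunov_form (hX : X ∈ 𝓝 e) (hf₀ : f e = 0) (hf : ContDiffAt ℝ 1 f e)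
    (hA : HasFDerivAt f A e) (hB : ∃ z, 0 < B z z)
    (hpos : ∀ z ≠ 0, 0 < B z (A z) + B (A z) z) : ¬IsStable f X e := by
  obtain ⟨z, hz⟩ := hB
  refine not_isStable_of_orbitalDeriv_pos hX
    ((hf.eventually (by simp)).mono fun _ h => h.continuousAt) (contDiff_bilin_sub B e)
    (frequently_bilin_pos hz e) ?_
  filter_upwards [eventually_nhdsWithin_iff.1 (eventually_orbitalDeriv_bilin_pos hA hf₀ hpos)]
    with x hx hBx
  exact hx fun hxe => (hxe ▸ hBx).ne rfl

end Linearization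

section Planar

open ContinuousLinearMap (fst snd)

variable {f : ℝ × ℝ → ℝ × ℝ} {X : Set (ℝ × ℝ)} {e : ℝ × ℝ} {a b c d : ℝ}

/-- The linear map of the plane with matrix `!![a, b; c, d]`. -/
noncomputable def planarMap (a b c d : ℝ) : ℝ × ℝ →L[ℝ] ℝ × ℝ :=
  (a • fst ℝ ℝ ℝ + b • snd ℝ ℝ ℝ).prod (c • fst ℝ ℝ ℝ + d • snd ℝ ℝ ℝ)

@[simp] lemma planarMap_apply (a b c d : ℝ) (z : ℝ × ℝ) :
    planarMap a b c d z = (a * z.1 + b * z.2, c * z.1 + d * z.2) := rfl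

/-- The Euclidean inner product on `ℝ × ℝ`, whose norm in Mathlib is the sup norm. -/
noncomputable def planarDot : ℝ × ℝ →L[ℝ] ℝ × ℝ →L[ℝ] ℝ :=
  (fst ℝ ℝ ℝ).smulRight (fst ℝ ℝ ℝ) + (snd ℝ ℝ ℝ).smulRight (snd ℝ ℝ ℝ)

@[simp] lemma planarDot_apply (z w : ℝ × ℝ) : planarDot z w = z.1 * w.1 + z.2 * w.2 := rfl

/-- The form `(z, w) ↦ ⟪adj A z, adj A w⟫ + det A * ⟪z, w⟫` for `A = !![a, b; c, d]`. It solves the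
Lyapunov equation for `A` since `adj A * A = det A` and `A + adj A = trace A`. -/
noncomputable def planarLyapunovForm (a b c d : ℝ) : ℝ × ℝ →L[ℝ] ℝ × ℝ →L[ℝ] ℝ :=
  planarDot.bilinearComp (planarMap d (-b) (-c) a) (planarMap d (-b) (-c) a) +
    (a * d - b * c) • planarDot

lemma planarDot_self_pos {z : ℝ × ℝ} (hz : z ≠ 0) : 0 < planarDot z z := by
  rcases eq_or_ne z.1 0 with h₁ | h₁
  · have h₂ : z.2 ≠ 0 := fun h₂ => hz (Prod.ext h₁ h₂)
    exact add_pos_of_nonneg_of_pos (mul_self_nonneg _) (mul_self_pos.2 h₂)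
  · exact add_pos_of_pos_of_nonneg (mul_self_pos.2 h₁) (mul_self_nonneg _)

lemma planarLyapunovForm_self_pos (hdet : 0 < a * d - b * c) {z : ℝ × ℝ} (hz : z ≠ 0) :
    0 < planarLyapunovForm a b c d z z :=
  add_pos_of_nonneg_of_pos (add_nonneg (mul_self_nonneg _) (mul_self_nonneg _))
    (mul_pos hdet (planarDot_self_pos hz))

lemma planarLyapunovForm_planarMap (a b c d : ℝ) (z : ℝ × ℝ) :
    planarLyapunovForm a b c d z (planarMap a b c d z) +
      planarLyapunovForm a b c d (planarMap a b c d z) z =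
        2 * (a * d - b * c) * (a + d) * planarDot z z := by
  simp only [planarLyapunovForm, add_apply, smul_apply, planarMap_apply,
    ContinuousLinearMap.bilinearComp_apply, planarDot_apply, smul_eq_mul]
  ring

theorem isAsymptoticallyStable_of_det_pos_of_trace_neg (hX : X ∈ 𝓝 e) (hf₀ : f e = 0)
    (hf : ContDiffAt ℝ 1 f e) (hA : HasFDerivAt f (planarMap a b c d) e)
    (hdet : 0 < a * d - b * c) (htrace : a + d < 0) : IsAsymptoticallyStable f X e := by
  refine isAsymptoticallyStable_of_lyapunov_form hX hf₀ hf hA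
    (fun _ => planarLyapunovForm_self_pos hdet) fun z hz => ?_
  rw [planarLyapunovForm_planarMap]
  exact mul_neg_of_neg_of_pos (mul_neg_of_pos_of_neg (by positivity) htrace)
    (planarDot_self_pos hz)

theorem not_isStable_of_det_pos_of_trace_pos (hX : X ∈ 𝓝 e) (hf₀ : f e = 0)
    (hf : ContDiffAt ℝ 1 f e) (hA : HasFDerivAt f (planarMap a b c d) e)
    (hdet : 0 < a * d - b * c) (htrace : 0 < a + d) : ¬IsStable f X e := by
  refine not_isStable_of_lyapunov_form hX hf₀ hf hA
    ⟨(1, 0), planarLyapunovForm_self_pos hdet (by simp)⟩ fun z hz => ?_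
  rw [planarLyapunovForm_planarMap]
  have := planarDot_self_pos hz
  positivity

end Planar

section Network

variable {L C r E P : ℝ} {e : ℝ × ℝ}

lemma stateSpace_mem_nhds (he : e ∈ stateSpace) : stateSpace ∈ 𝓝 e :=
  (isOpen_lt continuous_const continuous_snd).mem_nhds he

lemma contDiffAt_network (L C r E P : ℝ) (he : e ∈ stateSpace) :
    ContDiffAt ℝ 1 (network L C r E P) e := by
  have hv : e.2 ≠ 0 := he.ne'
  unfold network
  fun_prop (disch := assumption)

lemma hasFDerivAt_network (L C r E P : ℝ) (he : e ∈ stateSpace) :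
    HasFDerivAt (network L C r E P)
      (planarMap (-r / L) (-1 / L) (1 / C) (P / (C * e.2 ^ 2))) e := by
  have hi : HasFDerivAt (fun x : ℝ × ℝ => x.1) (.fst ℝ ℝ ℝ) e := hasFDerivAt_fst
  have hv : HasFDerivAt (fun x : ℝ × ℝ => x.2) (.snd ℝ ℝ ℝ) e := hasFDerivAt_snd
  have hvinv := (hasDerivAt_inv (ne_of_gt he)).comp_hasFDerivAt e hv
  have hcurrent : HasFDerivAt (fun x : ℝ × ℝ => L⁻¹ * (-r * x.1 - x.2 + E)) _ e :=
    (((hi.const_mul (-r)).sub hv).add_const E).const_mul L⁻¹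
  have hvoltage : HasFDerivAt (fun x : ℝ × ℝ => C⁻¹ * (x.1 - P * x.2⁻¹)) _ e :=
    (hi.sub (hvinv.const_mul P)).const_mul C⁻¹
  refine ((hcurrent.prodMk hvoltage).congr_fderiv ?_).congr_of_eventuallyEq (.of_eq ?_)
  · ext <;> simp <;> ring
  · ext x <;> simp only [network] <;> ring

lemma isEquilibrium_network_iff (hL : L ≠ 0) (hC : C ≠ 0) :
    IsEquilibrium (network L C r E P) stateSpace e ↔
      0 < e.2 ∧ r * e.1 + e.2 = E ∧ e.1 * e.2 = P := by
  refine and_congr_right fun hv => ?_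
  have hv : e.2 ≠ 0 := hv.ne'
  simp only [network, Prod.mk_eq_zero, div_eq_zero_iff, hL, hC, or_false]
  refine and_congr ⟨fun h => by linarith, fun h => by linarith⟩ ?_
  rw [sub_eq_zero, eq_div_iff hv]

lemma jacobian_det (hL : L ≠ 0) (hC : C ≠ 0) {v : ℝ} (hv : v ≠ 0) :
    -r / L * (P / (C * v ^ 2)) - -1 / L * (1 / C) = (v ^ 2 - r * P) / (L * C * v ^ 2) := by
  field_simp
  ring

lemma jacobian_trace (hL : L ≠ 0) (hC : C ≠ 0) {v : ℝ} (hv : v ≠ 0) :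
    -r / L + P / (C * v ^ 2) = (L * P - r * C * v ^ 2) / (L * C * v ^ 2) := by
  field_simp
  ring

theorem isAsymptoticallyStable_network (hL : 0 < L) (hC : 0 < C)
    (he : IsEquilibrium (network L C r E P) stateSpace e) (hdet : r * P < e.2 ^ 2)
    (htrace : L * P < r * C * e.2 ^ 2) :
    IsAsymptoticallyStable (network L C r E P) stateSpace e := by
  have hv : 0 < e.2 := he.1
  refine isAsymptoticallyStable_of_det_pos_of_trace_neg (stateSpace_mem_nhds he.1) he.2
    (contDiffAt_network L C r E P he.1) (hasFDerivAt_network L C r E P he.1) ?_ ?_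
  · rw [jacobian_det hL.ne' hC.ne' hv.ne']
    exact div_pos (sub_pos.2 hdet) (by positivity)
  · rw [jacobian_trace hL.ne' hC.ne' hv.ne']
    exact div_neg_of_neg_of_pos (sub_neg.2 htrace) (by positivity)

theorem not_isStable_network_of_trace_pos (hL : 0 < L) (hC : 0 < C)
    (he : IsEquilibrium (network L C r E P) stateSpace e) (hdet : r * P < e.2 ^ 2)
    (htrace : r * C * e.2 ^ 2 < L * P) : ¬IsStable (network L C r E P) stateSpace e := by
  have hv : 0 < e.2 := he.1
  refine not_isStable_of_det_pos_of_trace_pos (stateSpace_mem_nhds he.1) he.2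
    (contDiffAt_network L C r E P he.1) (hasFDerivAt_network L C r E P he.1) ?_ ?_
  · rw [jacobian_det hL.ne' hC.ne' hv.ne']
    exact div_pos (sub_pos.2 hdet) (by positivity)
  · rw [jacobian_trace hL.ne' hC.ne' hv.ne']
    exact div_pos (sub_pos.2 htrace) (by positivity)

end Network

section SaddleNode

variable {L C r E P α : ℝ} {e x : ℝ × ℝ}

/-- Chetaev's function for the saddle-node `e`. The first factor is constant along the linearized
flow, and its orbital derivative is `(x.2 - e.2) ^ 2 / x.2`; for small `α > 0` the second factor
makes the orbital derivative of the product positive also where that one vanishes. -/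
def saddleNodeFunction (L C r α : ℝ) (e x : ℝ × ℝ) : ℝ :=
  -(L * (x.1 - e.1) + r * C * (x.2 - e.2)) * (1 + α * (x.1 - e.1))

lemma contDiff_saddleNodeFunction (L C r α : ℝ) (e : ℝ × ℝ) :
    ContDiff ℝ 1 (saddleNodeFunction L C r α e) := by
  unfold saddleNodeFunction
  fun_prop

lemma saddleNodeFunction_self (L C r α : ℝ) (e : ℝ × ℝ) : saddleNodeFunction L C r α e e = 0 := by
  simp [saddleNodeFunction]

lemma orbitalDeriv_saddleNodeFunction (L C r α : ℝ) (f : ℝ × ℝ → ℝ × ℝ) (e x : ℝ × ℝ) :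
    orbitalDeriv f (saddleNodeFunction L C r α e) x =
      -(L * (f x).1 + r * C * (f x).2) * (1 + α * (x.1 - e.1)) -
        (L * (x.1 - e.1) + r * C * (x.2 - e.2)) * (α * (f x).1) := by
  have hp : HasFDerivAt (fun y : ℝ × ℝ => y.1 - e.1) (.fst ℝ ℝ ℝ) x := hasFDerivAt_fst.sub_const e.1
  have hq : HasFDerivAt (fun y : ℝ × ℝ => y.2 - e.2) (.snd ℝ ℝ ℝ) x := hasFDerivAt_snd.sub_const e.2
  have h : HasFDerivAt (saddleNodeFunction L C r α e) _ x :=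
    ((hp.const_mul L).add (hq.const_mul (r * C))).neg.mul ((hp.const_mul α).const_add 1)
  rw [orbitalDeriv, h.fderiv]
  simp only [Pi.neg_apply, Pi.add_apply, add_apply, smul_apply, neg_apply,
    ContinuousLinearMap.coe_fst', ContinuousLinearMap.coe_snd', smul_eq_mul]
  ring

lemma frequently_saddleNodeFunction_pos (hL : 0 < L) (C r α : ℝ) (e : ℝ × ℝ) :
    ∃ᶠ x in 𝓝 e, 0 < saddleNodeFunction L C r α e x := by
  have hlim : Tendsto (fun s : ℝ => (e.1 - s, e.2)) (𝓝[>] 0) (𝓝 e) :=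
    (Continuous.tendsto' (by fun_prop) 0 e (by simp)).mono_left nhdsWithin_le_nhds
  have hfactor : ∀ᶠ s in 𝓝[>] (0 : ℝ), 0 < 1 - α * s :=
    (Continuous.tendsto' (by fun_prop) 0 1 (by simp)).mono_left nhdsWithin_le_nhds
      |>.eventually_const_lt one_pos
  refine hlim.frequently (Eventually.frequently ?_)
  filter_upwards [hfactor, self_mem_nhdsWithin] with s hs hs₀
  have := mul_pos (mul_pos hL hs₀) hs
  simpa [saddleNodeFunction, ← sub_eq_add_neg] using this

lemma quadratic_pos {a b c x y : ℝ} (ha : 0 < a) (hdisc : b ^ 2 < 4 * a * c) (hy : y ≠ 0) :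
    0 < a * x ^ 2 + b * x * y + c * y ^ 2 := by
  have hsq : 4 * a * (a * x ^ 2 + b * x * y + c * y ^ 2) =
      (2 * a * x + b * y) ^ 2 + (4 * a * c - b ^ 2) * y ^ 2 := by ring
  have : 0 < (4 * a * c - b ^ 2) * y ^ 2 := mul_pos (sub_pos.2 hdisc) (by positivity)
  refine pos_of_mul_pos_right (a := 4 * a) (hsq ▸ ?_) (by positivity)
  positivity

lemma orbitalDeriv_network_saddleNodeFunction (hL : L ≠ 0) (hC : C ≠ 0)
    (he : IsEquilibrium (network L C r E P) stateSpace e) (hdet : r * P = e.2 ^ 2)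
    (hx : x ∈ stateSpace) :
    orbitalDeriv (network L C r E P) (saddleNodeFunction L C r α e) x =
      (x.2 - e.2) ^ 2 / x.2 * (1 + α * (x.1 - e.1)) +
        α * (L * (x.1 - e.1) + r * C * (x.2 - e.2)) * (r * (x.1 - e.1) + (x.2 - e.2)) / L := by
  obtain ⟨hv, hcurrent, hvoltage⟩ := (isEquilibrium_network_iff hL hC).1 he
  have hx₂ : x.2 ≠ 0 := ne_of_gt hx
  have hE : E = 2 * e.2 := by
    refine mul_right_cancel₀ hv.ne' ?_
    linear_combination hdet + r * hvoltage - e.2 * hcurrent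
  have hsum : -(L * (network L C r E P x).1 + r * C * (network L C r E P x).2) =
      (x.2 - e.2) ^ 2 / x.2 := by
    simp only [network]
    field_simp
    rw [hE]
    linear_combination hdet
  have hfst : (network L C r E P x).1 = -(r * (x.1 - e.1) + (x.2 - e.2)) / L := by
    simp only [network]
    congr 1
    linear_combination -hcurrent
  rw [orbitalDeriv_saddleNodeFunction, hsum, hfst]
  ring

lemma orbitalDeriv_network_saddleNodeFunction_pos (hL : 0 < L) (hC : C ≠ 0)
    (he : IsEquilibrium (network L C r E P) stateSpace e) (hdet : r * P = e.2 ^ 2) (hα : 0 < α)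
    (hα' : α * e.2 * (L - r ^ 2 * C) ^ 2 < r * L ^ 2) (hx : x ∈ stateSpace)
    (hv : x.2 < 2 * e.2) (hp : 1 / 2 < 1 + α * (x.1 - e.1))
    (hW : 0 < saddleNodeFunction L C r α e x) :
    0 < orbitalDeriv (network L C r E P) (saddleNodeFunction L C r α e) x := by
  have he₂ : 0 < e.2 := he.1
  have hx₂ : 0 < x.2 := hx
  rw [orbitalDeriv_network_saddleNodeFunction hL.ne' hC he hdet hx]
  set p := x.1 - e.1
  set q := x.2 - e.2
  have hu : 0 < -(L * p + r * C * q) := pos_of_mul_pos_left hW (by linarith)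
  -- Bounding `x.2` by `2 * e.2` and `1 + α * p` by `1 / 2` leaves a quadratic form in `q` and
  -- `u = -(L * p + r * C * q)`, whose discriminant is negative by `hα'`.
  have hform : 0 < 1 / (4 * e.2) * q ^ 2 +
      -(α * (L - r ^ 2 * C) / L ^ 2) * q * -(L * p + r * C * q) +
        α * r / L ^ 2 * (-(L * p + r * C * q)) ^ 2 := by
    refine quadratic_pos (by positivity) ?_ hu.ne'
    rw [neg_sq, div_pow, ← sub_pos]
    have : 4 * (1 / (4 * e.2)) * (α * r / L ^ 2) - (α * (L - r ^ 2 * C)) ^ 2 / (L ^ 2) ^ 2 =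
        α * (r * L ^ 2 - α * e.2 * (L - r ^ 2 * C) ^ 2) / (e.2 * L ^ 4) := by
      field_simp
    rw [this]
    exact div_pos (mul_pos hα (sub_pos.2 hα')) (by positivity)
  calc 0 < _ := hform
    _ = q ^ 2 / (2 * e.2) * (1 / 2) + α * (L * p + r * C * q) * (r * p + q) / L := by
      field_simp
      ring
    _ ≤ q ^ 2 / x.2 * (1 + α * p) + α * (L * p + r * C * q) * (r * p + q) / L := by
      gcongr

theorem not_isStable_network_of_det_eq_zero (hL : 0 < L) (hC : C ≠ 0) (hr : 0 < r)
    (he : IsEquilibrium (network L C r E P) stateSpace e) (hdet : r * P = e.2 ^ 2) :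
    ¬IsStable (network L C r E P) stateSpace e := by
  have hv : 0 < e.2 := he.1
  obtain ⟨α, hα, hα'⟩ : ∃ α > 0, α * e.2 * (L - r ^ 2 * C) ^ 2 < r * L ^ 2 := by
    refine ⟨r * L ^ 2 / (e.2 * ((L - r ^ 2 * C) ^ 2 + 1)), by positivity, ?_⟩
    rw [div_mul_eq_mul_div, div_mul_eq_mul_div, div_lt_iff₀ (by positivity)]
    have : 0 < r * L ^ 2 * e.2 := by positivity
    linarith
  refine not_isStable_of_orbitalDeriv_pos (stateSpace_mem_nhds he.1)
    (((contDiffAt_network L C r E P he.1).eventually (by simp)).mono fun _ h => h.continuousAt)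
    (contDiff_saddleNodeFunction L C r α e)
    (by simpa only [saddleNodeFunction_self] using frequently_saddleNodeFunction_pos hL C r α e) ?_
  have hp : ∀ᶠ x : ℝ × ℝ in 𝓝 e, 1 / 2 < 1 + α * (x.1 - e.1) :=
    (Continuous.tendsto' (by fun_prop) e 1 (by simp)).eventually_const_lt (by norm_num)
  have hv₂ : ∀ᶠ x : ℝ × ℝ in 𝓝 e, x.2 < 2 * e.2 :=
    continuous_snd.continuousAt.eventually_lt_const (by linarith)
  filter_upwards [stateSpace_mem_nhds he.1, hp, hv₂] with x hx hxp hxv hW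
  exact orbitalDeriv_network_saddleNodeFunction_pos hL hC he hdet hα hα' hx hxv hxp
    (by rwa [saddleNodeFunction_self] at hW)

end SaddleNode

section HighVoltageEquilibrium

variable {L C r E P : ℝ}

lemma isEquilibrium_equilibriumPoint_iff (hL : L ≠ 0) (hC : C ≠ 0) (hr : r ≠ 0) (hE : 0 < E) :
    IsEquilibrium (network L C r E P) stateSpace (equilibriumPoint r E P) ↔ 0 ≤ discr r E P := by
  have hv : 0 < (E + √(discr r E P)) / 2 := by positivity
  have hcurrent : r * ((E - √(discr r E P)) / (2 * r)) + (E + √(discr r E P)) / 2 = E := by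
    field_simp
    ring
  rw [isEquilibrium_network_iff hL hC]
  simp only [equilibriumPoint, hv, hcurrent, true_and]
  have hpower : (E - √(discr r E P)) / (2 * r) * ((E + √(discr r E P)) / 2) = P ↔
      √(discr r E P) ^ 2 = discr r E P := by
    rw [div_mul_div_comm, div_eq_iff (by positivity), discr]
    constructor <;> intro h <;> linarith
  rw [hpower]
  exact ⟨fun h => h ▸ sq_nonneg _, Real.sq_sqrt⟩

lemma equilibriumPoint_snd_pos (hE : 0 < E) (r P : ℝ) : 0 < (equilibriumPoint r E P).2 := by
  unfold equilibriumPoint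
  positivity

lemma equilibriumPoint_snd_sq_sub (hΔ : 0 ≤ discr r E P) :
    (equilibriumPoint r E P).2 ^ 2 - r * P = (equilibriumPoint r E P).2 * √(discr r E P) := by
  have hsq := Real.sq_sqrt hΔ
  simp only [equilibriumPoint]
  rw [discr] at hsq ⊢
  linarith

lemma equilibriumPoint_trace_eq (L C : ℝ) (hΔ : 0 ≤ discr r E P) :
    r * (r * C * (equilibriumPoint r E P).2 ^ 2 - L * P) = (equilibriumPoint r E P).2 / 2 *
      ((L + C * r ^ 2) * √(discr r E P) - (L - C * r ^ 2) * E) := by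
  have hsq := Real.sq_sqrt hΔ
  simp only [equilibriumPoint]
  rw [discr] at hsq ⊢
  linear_combination (-L / 4) * hsq

lemma lt_equilibriumPoint_snd_sq (hE : 0 < E) (hΔ : 0 < discr r E P) :
    r * P < (equilibriumPoint r E P).2 ^ 2 := by
  rw [← sub_pos, equilibriumPoint_snd_sq_sub hΔ.le]
  exact mul_pos (equilibriumPoint_snd_pos hE r P) (Real.sqrt_pos.2 hΔ)

theorem isAsymptoticallyStable_equilibriumPoint (hL : 0 < L) (hC : 0 < C) (hr : 0 < r) (hE : 0 < E)
    (hΔ : 0 < discr r E P) (htrace : (L - C * r ^ 2) * E < (L + C * r ^ 2) * √(discr r E P)) :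
    IsAsymptoticallyStable (network L C r E P) stateSpace (equilibriumPoint r E P) := by
  refine isAsymptoticallyStable_network hL hC
    ((isEquilibrium_equilibriumPoint_iff hL.ne' hC.ne' hr.ne' hE).2 hΔ.le)
    (lt_equilibriumPoint_snd_sq hE hΔ) (sub_pos.1 (pos_of_mul_pos_right ?_ hr.le))
  rw [equilibriumPoint_trace_eq L C hΔ.le]
  exact mul_pos (half_pos (equilibriumPoint_snd_pos hE r P)) (sub_pos.2 htrace)

theorem not_isStable_equilibriumPoint (hL : 0 < L) (hC : 0 < C) (hr : 0 < r) (hE : 0 < E)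
    (hΔ : 0 < discr r E P) (htrace : (L + C * r ^ 2) * √(discr r E P) < (L - C * r ^ 2) * E) :
    ¬IsStable (network L C r E P) stateSpace (equilibriumPoint r E P) := by
  refine not_isStable_network_of_trace_pos hL hC
    ((isEquilibrium_equilibriumPoint_iff hL.ne' hC.ne' hr.ne' hE).2 hΔ.le)
    (lt_equilibriumPoint_snd_sq hE hΔ) (sub_neg.1 (neg_of_mul_neg_right ?_ hr.le))
  rw [equilibriumPoint_trace_eq L C hΔ.le]
  exact mul_neg_of_pos_of_neg (half_pos (equilibriumPoint_snd_pos hE r P)) (sub_neg.2 htrace)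

theorem discr_pos_of_isStable (hL : 0 < L) (hC : C ≠ 0) (hr : 0 < r) (hE : 0 < E)
    (h : IsStable (network L C r E P) stateSpace (equilibriumPoint r E P)) : 0 < discr r E P := by
  have hΔ := (isEquilibrium_equilibriumPoint_iff hL.ne' hC hr.ne' hE).1 h.1
  refine hΔ.lt_of_ne fun hzero => not_isStable_network_of_det_eq_zero hL hC hr h.1 ?_ h
  have hdet := equilibriumPoint_snd_sq_sub hΔ
  rw [← hzero, Real.sqrt_zero, mul_zero, sub_eq_zero] at hdet
  exact hdet.symm

lemma discr_pos_iff (hr : 0 < r) : 0 < discr r E P ↔ P < E ^ 2 / (4 * r) := by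
  rw [discr, sub_pos, lt_div_iff₀ (by positivity)]
  ring_nf

lemma sq_mul_discr (L C r E P : ℝ) : (L + C * r ^ 2) ^ 2 * discr r E P =
    ((L - C * r ^ 2) * E) ^ 2 + 4 * r * (E ^ 2 * C * L * r - P * (L + C * r ^ 2) ^ 2) := by
  rw [discr]
  ring

lemma sqrt_sq_mul_discr (hLC : 0 ≤ L + C * r ^ 2) :
    √((L + C * r ^ 2) ^ 2 * discr r E P) = (L + C * r ^ 2) * √(discr r E P) := by
  rw [Real.sqrt_mul (sq_nonneg _), Real.sqrt_sq hLC]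

lemma lt_criticalPower_iff (hr : 0 < r) (hLC : 0 < L + C * r ^ 2)
    (hE : 0 ≤ (L - C * r ^ 2) * E) :
    P < E ^ 2 * C * L * r / (L + C * r ^ 2) ^ 2 ↔
      (L - C * r ^ 2) * E < (L + C * r ^ 2) * √(discr r E P) := by
  rw [← sqrt_sq_mul_discr hLC.le, Real.lt_sqrt hE, sq_mul_discr, lt_add_iff_pos_right,
    mul_pos_iff_of_pos_left (by positivity), sub_pos, lt_div_iff₀ (by positivity)]

lemma criticalPower_lt_iff (hr : 0 < r) (hLC : 0 < L + C * r ^ 2)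
    (hE : 0 < (L - C * r ^ 2) * E) :
    E ^ 2 * C * L * r / (L + C * r ^ 2) ^ 2 < P ↔
      (L + C * r ^ 2) * √(discr r E P) < (L - C * r ^ 2) * E := by
  rw [← sqrt_sq_mul_discr hLC.le, Real.sqrt_lt' hE, sq_mul_discr, add_lt_iff_neg_left,
    ← neg_pos, ← mul_neg, mul_pos_iff_of_pos_left (by positivity), neg_sub, sub_pos,
    div_lt_iff₀ (by positivity)]

end HighVoltageEquilibrium

end CPL

open CPL in
theorem mainTheorem8_general (L₁ C₁ r₁ E P : ℝ)
    (hL : 0 < L₁) (hC : 0 < C₁) (hr : 0 < r₁) (hE : 0 < E) :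
    (C₁ < L₁ / r₁ ^ 2 →
      (IsStable (network L₁ C₁ r₁ E P) stateSpace (equilibriumPoint r₁ E P) →
        P ≤ E ^ 2 * C₁ * L₁ * r₁ / (L₁ + C₁ * r₁ ^ 2) ^ 2) ∧
      (P < E ^ 2 * C₁ * L₁ * r₁ / (L₁ + C₁ * r₁ ^ 2) ^ 2 →
        IsAsymptoticallyStable (network L₁ C₁ r₁ E P) stateSpace (equilibriumPoint r₁ E P))) ∧
    (L₁ / r₁ ^ 2 ≤ C₁ →
      (IsStable (network L₁ C₁ r₁ E P) stateSpace (equilibriumPoint r₁ E P) ↔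
        P < E ^ 2 / (4 * r₁))) := by
  have hLC : 0 < L₁ + C₁ * r₁ ^ 2 := by positivity
  refine ⟨fun hlt => ?_, fun hle => ?_⟩
  · have hpos : 0 < (L₁ - C₁ * r₁ ^ 2) * E :=
      mul_pos (sub_pos.2 ((lt_div_iff₀ (by positivity)).1 hlt)) hE
    refine ⟨fun hstable => le_of_not_gt fun hP => ?_, fun hP => ?_⟩
    · have hΔ := discr_pos_of_isStable hL hC.ne' hr hE hstable
      exact not_isStable_equilibriumPoint hL hC hr hE hΔ
        ((criticalPower_lt_iff hr hLC hpos).1 hP) hstable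
    · have htrace := (lt_criticalPower_iff hr hLC hpos.le).1 hP
      have hΔ : 0 < discr r₁ E P :=
        Real.sqrt_pos.1 (pos_of_mul_pos_right (hpos.trans htrace) hLC.le)
      exact isAsymptoticallyStable_equilibriumPoint hL hC hr hE hΔ htrace
  · rw [← discr_pos_iff hr]
    refine ⟨discr_pos_of_isStable hL hC.ne' hr hE, fun hΔ =>
      (isAsymptoticallyStable_equilibriumPoint hL hC hr hE hΔ ?_).1⟩
    calc (L₁ - C₁ * r₁ ^ 2) * E ≤ 0 :=
          mul_nonpos_of_nonpos_of_nonneg (sub_nonpos.2 ((div_le_iff₀ (by positivity)).1 hle)) hE.le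
      _ < (L₁ + C₁ * r₁ ^ 2) * √(discr r₁ E P) := mul_pos hLC (Real.sqrt_pos.2 hΔ)

theorem mainTheorem8 (L₁ C₁ r₁ E P : ℝ)
    (hL : 0 < L₁) (hC : 0 < C₁) (hr : 0 < r₁) (hE : 0 < E) (hP : 0 ≤ P) :
    (C₁ < L₁ / r₁ ^ 2 →
      (CPL.IsStable (CPL.network L₁ C₁ r₁ E P) CPL.stateSpace (CPL.equilibriumPoint r₁ E P) →
        P ≤ E ^ 2 * C₁ * L₁ * r₁ / (L₁ + C₁ * r₁ ^ 2) ^ 2) ∧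
      (P < E ^ 2 * C₁ * L₁ * r₁ / (L₁ + C₁ * r₁ ^ 2) ^ 2 →
        CPL.IsAsymptoticallyStable (CPL.network L₁ C₁ r₁ E P) CPL.stateSpace
          (CPL.equilibriumPoint r₁ E P))) ∧
    (L₁ / r₁ ^ 2 ≤ C₁ →
      (CPL.IsStable (CPL.network L₁ C₁ r₁ E P) CPL.stateSpace (CPL.equilibriumPoint r₁ E P) ↔
        P < E ^ 2 / (4 * r₁))) :=
  mainTheorem8_general L₁ C₁ r₁ E P hL hC hr hE
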